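/- For $n\ge 1$ and $1\le i\le 2^{n-1}$ let $\eta_{n,i}:[0,1]\to\mathbb R$ be the Faber--Schauder function equal to $2^{(n-1)/2}\bigl(t-\tfrac{2i-2}{2^n}\bigr)$ on $\bigl[\tfrac{2i-2}{2^n},\tfrac{2i-1}{2^n}\bigr]$, to $2^{(n-1)/2}\bigl(\tfrac{2i}{2^n}-t\bigr)$ on $\bigl[\tfrac{2i-1}{2^n},\tfrac{2i}{2^n}\bigr]$, and to $0$ elsewhere. Let $X_0$ and $X_{n,i}$ ($n\ge1$, $1\le i\le 2^{n-1}$) be independent standard normal random variables on a probability space, and let $B$ be standard Brownian motion on $[0,1]$ given by the Lévy--Ciesielski expansion: almost surely, for all $t\in[0,1]$, $$B(t)=X_0\,t+\sum_{n=1}^{\infty}\sum_{i=1}^{2^{n-1}}X_{n,i}\,\eta_{n,i}(t),$$ with truncations $$B_N(t)=X_0\,t+\sum_{n=1}^{N}\sum_{i=1}^{2^{n-1}}X_{n,i}\,\eta_{n,i}(t)\qquad(N\ge 1).$$ Let $r>0$, $\sigma>0$ and $S(0),K\in\mathbb R$, and define the discounted payoff of the continuous arithmetic Asian call option with strike $K$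 and maturity $1$ in the Black--Scholes model, and its approximation, by $$P=e^{-r}\max\Bigl(S(0)\int_0^1 e^{(r-\sigma^2/2)t+\sigma B(t)}\,dt-K,\,0\Bigr),\qquad P_N=e^{-r}\max\Bigl(S(0)\int_0^1 e^{(r-\sigma^2/2)t+\sigma B_N(t)}\,dt-K,\,0\Bigr).$$ Then, almost surely, the series for $B(t)$ converges for every $t\in[0,1]$ and $B$ is continuous on $[0,1]$ (so that $P$ is well defined), $P-P_N$ is integrable for every $N\ge 1$, and, with $d=2^N$, there are constants $C,C'>0$ independent of $N$ such that for all $N\ge 1$ $$\mathbb E\bigl[|P-P_N|\bigr]\le C\,\frac{\sqrt N}{2^{N/2}}\qquad\text{and}\qquad \mathbb E\bigl[|P-P_N|\bigr]\le C'\sqrt{\frac{\ln d}{d}}.$$ -/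

import Mathlib

open MeasureTheory ProbabilityTheory Set

noncomputable section

open scoped Classical in
/-- The Faber–Schauder function `η_{n,i}` (`n ≥ 1`, `1 ≤ i ≤ 2^(n-1)`): the hat function supported on
`[(2i-2)/2^n, 2i/2^n]` with slopes `± 2^((n-1)/2)`. -/
def faberSchauder (n i : ℕ) (t : ℝ) : ℝ :=
  if t ∈ Icc ((2 * (i : ℝ) - 2) / 2 ^ n) ((2 * (i : ℝ) - 1) / 2 ^ n) then
    (2 : ℝ) ^ (((n : ℝ) - 1) / 2) * (t - (2 * (i : ℝ) - 2) / 2 ^ n)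
  else if t ∈ Icc ((2 * (i : ℝ) - 1) / 2 ^ n) ((2 * (i : ℝ)) / 2 ^ n) then
    (2 : ℝ) ^ (((n : ℝ) - 1) / 2) * ((2 * (i : ℝ)) / 2 ^ n - t)
  else 0

/-- The level-`n` part `∑_{i=1}^{2^(n-1)} x_{n,i} η_{n,i}(t)` (`n ≥ 1`). The coefficients are stored in
one sequence: `x 0` is `x_0`, and `x (2^(n-1) + (i-1))` is `x_{n,i}`; this is a bijective labelling. -/
def lcLevel (x : ℕ → ℝ) (n : ℕ) (t : ℝ) : ℝ :=
  ∑ i ∈ Finset.Icc 1 (2 ^ (n - 1)), x (2 ^ (n - 1) + (i - 1)) * faberSchauder n i t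

/-- The truncated Lévy–Ciesielski expansion
`B_N(x)(t) = x_0 t + ∑_{n=1}^N ∑_{i=1}^{2^(n-1)} x_{n,i} η_{n,i}(t)`. -/
def lcTrunc (x : ℕ → ℝ) (N : ℕ) (t : ℝ) : ℝ :=
  x 0 * t + ∑ n ∈ Finset.Icc 1 N, lcLevel x n t

/-- The full Lévy–Ciesielski expansion
`B(x)(t) = x_0 t + ∑_{n=1}^∞ ∑_{i=1}^{2^(n-1)} x_{n,i} η_{n,i}(t)`. -/
def lcPath (x : ℕ → ℝ) (t : ℝ) : ℝ :=
  x 0 * t + ∑' n : ℕ, lcLevel x (n + 1) t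

/-- The Black–Scholes asset price `S(t) = S(0) exp((r - σ²/2) t + σ b(t))` driven by the path `b`. -/
def assetPrice (S₀ r σ : ℝ) (b : ℝ → ℝ) (t : ℝ) : ℝ :=
  S₀ * Real.exp ((r - σ ^ 2 / 2) * t + σ * b t)

/-- The discounted payoff, with maturity `T = 1`, strike `K` and risk-free rate `r`, of the continuous
arithmetic Asian call on an asset with price path `S`. -/
def asianCallPayoff (r K : ℝ) (S : ℝ → ℝ) : ℝ :=
  Real.exp (-r) * max ((∫ t in (0 : ℝ)..1, S t) - K) 0

end

/-! ### Faber–Schauder functions and pathwise convergence -/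

section Deterministic

open Filter Topology

/-! At a fixed `t` at most one hat per level is nonzero, and it is of size at most `2^(-(n+1)/2)`.
Hence `B_M(t) - B_N(t)` is a sum of terms `c_n X_{k n}` with geometrically decaying `c_n`
(`exists_lcTrunc_eq`). The payoff error is at most a constant times the time integral of `|B_M -
B_N| (e^{σ B_M} + e^{σ B_N})` (`abs_asianCallPayoff_sub_le`). For each `t` its expectation is
`O(2^(-N/2))`, uniformly in `M` and `t`, since the exponential moments are bounded
(`integrable_exp_lcTrunc`). Tonelli integrates this over `t`, and Fatou lets `M → ∞`. Working at
fixed `t` instead of with the supremum over `t` gives `2^(-N/2)` without the factor `√N`; both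
stated bounds are weaker. Pathwise convergence comes from the almost sure growth bound
`ae_exists_pow_le`. -/

theorem faberSchauder_eq (n i : ℕ) (t : ℝ) :
    faberSchauder n i t =
      (2 : ℝ) ^ (((n : ℝ) - 1) / 2) / 2 ^ n * max 0 (1 - |2 ^ n * t - (2 * (i : ℝ) - 1)|) := by
  have ha : (0 : ℝ) < 2 ^ n := by positivity
  unfold faberSchauder
  simp only [mem_Icc, div_le_iff₀ ha, le_div_iff₀ ha]
  split_ifs with h1 h2
  · rw [abs_of_nonpos (by linarith), max_eq_right (by linarith)]
    field_simp
    ring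
  · rw [abs_of_nonneg (by linarith), max_eq_right (by linarith)]
    field_simp
    ring
  · rw [max_eq_left, mul_zero]
    rw [sub_nonpos, le_abs]
    by_contra! hc
    rcases le_total (t * 2 ^ n) (2 * (i : ℝ) - 1) with h | h
    · exact h1 ⟨by linarith, h⟩
    · exact h2 ⟨h, by linarith⟩

theorem continuous_faberSchauder (n i : ℕ) : Continuous (faberSchauder n i) := by
  rw [funext (faberSchauder_eq n i)]
  fun_prop

theorem abs_faberSchauder_le (n i : ℕ) (t : ℝ) :
    |faberSchauder n i t| ≤ √(1 / 2) ^ (n + 1) := by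
  have hA : ((2 : ℝ) ^ (((n : ℝ) - 1) / 2) / 2 ^ n) ^ 2 = (1 / 2) ^ (n + 1) := by
    rw [div_pow, ← Real.rpow_mul_natCast (by norm_num)]
    have : ((n : ℝ) - 1) / 2 * ((2 : ℕ) : ℝ) = n - 1 := by push_cast; ring
    rw [this, Real.rpow_sub_one (by norm_num), Real.rpow_natCast, one_div, inv_pow]
    field_simp
    ring
  have hm : |max 0 (1 - |2 ^ n * t - (2 * (i : ℝ) - 1)|)| ≤ 1 := by
    rw [abs_of_nonneg (le_max_left _ _)]
    exact max_le zero_le_one (by linarith [abs_nonneg (2 ^ n * t - (2 * (i : ℝ) - 1))])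
  rw [faberSchauder_eq, abs_mul]
  refine (mul_le_of_le_one_right (abs_nonneg _) hm).trans ?_
  refine abs_le_of_sq_le_sq ?_ (by positivity)
  rw [hA, ← pow_mul, mul_comm (n + 1) 2, pow_mul, Real.sq_sqrt (by norm_num)]

/-- The hats of one level have supports with disjoint interiors. If all vanish at `t`, any index
serves. -/
theorem exists_index_faberSchauder_eq_zero (n : ℕ) (t : ℝ) :
    ∃ i ∈ Finset.Icc 1 (2 ^ (n - 1)), ∀ j ∈ Finset.Icc 1 (2 ^ (n - 1)), j ≠ i →
      faberSchauder n j t = 0 := by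
  by_cases h : ∃ i ∈ Finset.Icc 1 (2 ^ (n - 1)), faberSchauder n i t ≠ 0
  · obtain ⟨i, hi, hne⟩ := h
    refine ⟨i, hi, fun j _ hji => ?_⟩
    by_contra hj
    have key : ∀ k : ℕ, faberSchauder n k t ≠ 0 → |2 ^ n * t - (2 * (k : ℝ) - 1)| < 1 := by
      intro k hk
      by_contra! hc
      exact hk (by rw [faberSchauder_eq, max_eq_left (by linarith), mul_zero])
    have h1 := abs_lt.1 (key i hne)
    have h2 := abs_lt.1 (key j hj)
    have h3 : (i : ℝ) < j + 1 := by linarith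
    have h4 : (j : ℝ) < i + 1 := by linarith
    norm_cast at h3 h4
    omega
  · push Not at h
    exact ⟨1, Finset.mem_Icc.2 ⟨le_rfl, Nat.one_le_two_pow⟩, fun j hj _ => h j hj⟩

/-- At a given time only one coefficient contributes at each level. -/
theorem exists_lcLevel_eq (n : ℕ) (t : ℝ) :
    ∃ k : ℕ, ∃ c : ℝ, 2 ^ n ≤ k ∧ k < 2 ^ (n + 1) ∧ |c| ≤ √(1 / 2) ^ (n + 2) ∧
      ∀ x : ℕ → ℝ, lcLevel x (n + 1) t = c * x k := by
  obtain ⟨i, hi, h⟩ := exists_index_faberSchauder_eq_zero (n + 1) t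
  refine ⟨2 ^ n + (i - 1), faberSchauder (n + 1) i t, Nat.le_add_right _ _, ?_,
    abs_faberSchauder_le _ _ _, fun x => ?_⟩
  · simp only [Nat.add_sub_cancel, Finset.mem_Icc] at hi
    rw [pow_succ]
    omega
  · unfold lcLevel
    rw [Finset.sum_eq_single i (fun j hj hji => by rw [h j hj hji, mul_zero])
      (fun hn => absurd hi hn), mul_comm, Nat.add_sub_cancel]

theorem lcTrunc_eq_range (x : ℕ → ℝ) (N : ℕ) (t : ℝ) :
    lcTrunc x N t = x 0 * t + ∑ n ∈ Finset.range N, lcLevel x (n + 1) t := by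
  rw [lcTrunc, Finset.range_eq_Ico, Finset.sum_Ico_add' (fun n => lcLevel x n t) 0 N 1]
  rfl

/-- Level `n + 1` uses the labels in `[2^n, 2^(n+1))`, so the selected labels increase strictly and
the selected coefficients remain independent. Neither `k` nor `c` depends on `x` or `N`; index `0`
is the linear term. -/
theorem exists_lcTrunc_eq (t : ℝ) :
    ∃ k : ℕ → ℕ, ∃ c : ℕ → ℝ, Function.Injective k ∧ c 0 = t ∧
      (∀ n, |c (n + 1)| ≤ √(1 / 2) ^ (n + 2)) ∧
      ∀ (x : ℕ → ℝ) (N : ℕ), lcTrunc x N t = ∑ n ∈ Finset.range (N + 1), c n * x (k n) := by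
  choose k c hk hk' hc h using fun n => exists_lcLevel_eq n t
  refine ⟨fun n => n.casesOn 0 k, fun n => n.casesOn t c, ?_, rfl, hc, fun x N => ?_⟩
  · refine StrictMono.injective (strictMono_nat_of_lt_succ fun n => ?_)
    cases n with
    | zero => exact (Nat.two_pow_pos 0).trans_le (hk 0)
    | succ n => exact (hk' n).trans_le (hk (n + 1))
  · rw [lcTrunc_eq_range, Finset.sum_range_succ', add_comm, mul_comm]
    simp only [h]
    rfl

theorem continuous_lcLevel (x : ℕ → ℝ) (n : ℕ) : Continuous (lcLevel x n) := by
  unfold lcLevel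
  exact continuous_finsetSum _ fun i _ => continuous_const.mul (continuous_faberSchauder n i)

theorem continuous_lcTrunc (x : ℕ → ℝ) (N : ℕ) : Continuous (lcTrunc x N) := by
  unfold lcTrunc
  exact (continuous_const.mul continuous_id).add
    (continuous_finsetSum _ fun n _ => continuous_lcLevel x n)

theorem measurable_lcTrunc (N : ℕ) :
    Measurable fun p : (ℕ → ℝ) × ℝ => lcTrunc p.1 N p.2 := by
  unfold lcTrunc lcLevel
  refine ((measurable_pi_apply 0).comp measurable_fst |>.mul measurable_snd).add ?_
  refine Finset.measurable_fun_sum _ fun n _ => Finset.measurable_fun_sum _ fun i _ => ?_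
  exact ((measurable_pi_apply _).comp measurable_fst).mul
    ((continuous_faberSchauder n i).measurable.comp measurable_snd)

/-- The hypothesis says `|x j| = O(j^(1/4))`; against hats of size `2^(-n/2)` this leaves
`O(2^(-n/4))` per level. -/
theorem exists_summable_bound_lcLevel {x : ℕ → ℝ} {T : ℝ}
    (hx : ∀ j, |x j| ^ 8 ≤ T * ((j : ℝ) + 1) ^ 2) :
    ∃ u : ℕ → ℝ, Summable u ∧ ∀ n t, |lcLevel x (n + 1) t| ≤ u n := by
  have hT : 0 ≤ T := by simpa using (by positivity : 0 ≤ |x 0| ^ 8).trans (hx 0)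
  have hρ : √√(1 / 2 : ℝ) ^ 8 = 1 / 4 := by
    rw [show 8 = 2 * 4 from rfl, pow_mul, Real.sq_sqrt (by positivity), show 4 = 2 * 2 from rfl,
      pow_mul, Real.sq_sqrt (by norm_num)]
    norm_num
  have hρ1 : √√(1 / 2 : ℝ) < 1 := by
    rw [Real.sqrt_lt' one_pos, Real.sqrt_lt' (by norm_num)]
    norm_num
  -- `T + 1` stands in for an eighth root of `T`: it is at least 1, so `T ≤ (T + 1)^8`.
  refine ⟨fun n => (T + 1) * √√(1 / 2) ^ n,
    (summable_geometric_of_lt_one (by positivity) hρ1).mul_left _, fun n t => ?_⟩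
  obtain ⟨k, c, -, hk, hc, h⟩ := exists_lcLevel_eq n t
  rw [h, abs_mul]
  refine (pow_le_pow_iff_left₀ (by positivity) (by positivity) (by norm_num : 8 ≠ 0)).1 ?_
  have hk2 : (k : ℝ) + 1 ≤ 2 ^ (n + 1) := by exact_mod_cast hk
  have h8 : |c| ^ 8 ≤ (1 / 16) ^ (n + 2) := by
    refine (pow_le_pow_left₀ (abs_nonneg _) hc 8).trans (le_of_eq ?_)
    rw [← pow_mul, mul_comm, pow_mul]
    congr 1
    rw [show 8 = 2 * 4 from rfl, pow_mul, Real.sq_sqrt (by norm_num)]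
    norm_num
  calc (|c| * |x k|) ^ 8 = |c| ^ 8 * |x k| ^ 8 := mul_pow _ _ _
    _ ≤ (1 / 16) ^ (n + 2) * (T * (2 ^ (n + 1)) ^ 2) := by
        gcongr
        exact (hx k).trans (by gcongr)
    _ = T / 64 * (1 / 4) ^ n := by
        have : (1 / 16 : ℝ) ^ n * (2 ^ n) ^ 2 = (1 / 4) ^ n := by
          rw [← pow_mul, mul_comm n 2, pow_mul, ← mul_pow]; norm_num
        rw [← this]; ring
    _ ≤ (T + 1) ^ 8 * (1 / 4) ^ n := by
        gcongr
        have : T + 1 ≤ (T + 1) ^ 8 := le_self_pow₀ (by linarith) (by norm_num)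
        linarith
    _ = ((T + 1) * √√(1 / 2) ^ n) ^ 8 := by
        rw [mul_pow, ← pow_mul, mul_comm n 8, pow_mul, hρ]

theorem continuous_lcPath {x : ℕ → ℝ} {T : ℝ} (hx : ∀ j, |x j| ^ 8 ≤ T * ((j : ℝ) + 1) ^ 2) :
    Continuous (lcPath x) := by
  obtain ⟨u, hu, hle⟩ := exists_summable_bound_lcLevel hx
  unfold lcPath
  exact (continuous_const.mul continuous_id).add
    (continuous_tsum (fun n => continuous_lcLevel x (n + 1)) hu hle)

theorem asianCallPayoff_congr {r K S₀ σ : ℝ} {b b' : ℝ → ℝ} (h : EqOn b b' (Icc 0 1)) :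
    asianCallPayoff r K (assetPrice S₀ r σ b) = asianCallPayoff r K (assetPrice S₀ r σ b') := by
  unfold asianCallPayoff
  congr 3
  refine intervalIntegral.integral_congr fun t ht => ?_
  rw [uIcc_of_le zero_le_one] at ht
  simp only [assetPrice, h ht]

theorem tendsto_asianCallPayoff_lcTrunc {x : ℕ → ℝ} {T : ℝ}
    (hx : ∀ j, |x j| ^ 8 ≤ T * ((j : ℝ) + 1) ^ 2) (S₀ r σ K : ℝ) :
    Tendsto (fun N => asianCallPayoff r K (assetPrice S₀ r σ (lcTrunc x N))) atTop
      (𝓝 (asianCallPayoff r K (assetPrice S₀ r σ (lcPath x)))) := by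
  obtain ⟨u, hu, hle⟩ := exists_summable_bound_lcLevel hx
  have hlim : ∀ t, Tendsto (fun N => lcTrunc x N t) atTop (𝓝 (lcPath x t)) := by
    intro t
    simp only [lcTrunc_eq_range, lcPath]
    exact ((Summable.of_norm_bounded hu fun n => hle n t).hasSum.tendsto_sum_nat).const_add _
  have hbd : ∀ N, ∀ t ∈ Ioc (0 : ℝ) 1, |lcTrunc x N t| ≤ |x 0| + ∑' n, u n := by
    intro N t ht
    rw [lcTrunc_eq_range]
    refine (abs_add_le _ _).trans (add_le_add ?_ ?_)
    · rw [abs_mul, abs_of_pos ht.1]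
      exact mul_le_of_le_one_right (abs_nonneg _) ht.2
    · refine (Finset.abs_sum_le_sum_abs _ _).trans ((Finset.sum_le_sum fun n _ => hle n t).trans ?_)
      exact hu.sum_le_tsum _ fun n _ => (abs_nonneg _).trans (hle n 0)
  unfold asianCallPayoff
  refine Tendsto.const_mul _ (Tendsto.max (Tendsto.sub_const ?_ _) tendsto_const_nhds)
  refine intervalIntegral.tendsto_integral_filter_of_dominated_convergence
    (fun _ => |S₀| * Real.exp (|r - σ ^ 2 / 2| + |σ| * (|x 0| + ∑' n, u n))) ?_ ?_ (by simp) ?_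
  · refine Eventually.of_forall fun N => Continuous.aestronglyMeasurable ?_
    have := continuous_lcTrunc x N
    unfold assetPrice
    fun_prop
  · refine Eventually.of_forall fun N => ae_of_all _ fun t ht => ?_
    rw [uIoc_of_le zero_le_one] at ht
    rw [assetPrice, Real.norm_eq_abs, abs_mul, Real.abs_exp]
    refine mul_le_mul_of_nonneg_left (Real.exp_le_exp.2 (add_le_add ?_ ?_)) (abs_nonneg _)
    · refine (le_abs_self _).trans ?_
      rw [abs_mul, abs_of_pos ht.1]
      exact mul_le_of_le_one_right (abs_nonneg _) ht.2
    · refine (le_abs_self _).trans ?_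
      rw [abs_mul]
      exact mul_le_mul_of_nonneg_left (hbd N t ht) (abs_nonneg _)
  · refine ae_of_all _ fun t _ => ?_
    unfold assetPrice
    exact Tendsto.const_mul _ ((Real.continuous_exp.tendsto _).comp
      (((hlim t).const_mul σ).const_add _))

/-! ### Stability of the payoff in the driving path -/

theorem abs_exp_sub_exp_le (a b : ℝ) :
    |Real.exp a - Real.exp b| ≤ |a - b| * (Real.exp a + Real.exp b) := by
  wlog h : b ≤ a generalizing a b
  · rw [abs_sub_comm, abs_sub_comm a, add_comm]
    exact this b a (le_of_not_ge h)
  rw [abs_of_nonneg (sub_nonneg.2 (Real.exp_le_exp.2 h)), abs_of_nonneg (sub_nonneg.2 h)]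
  have h1 : Real.exp b = Real.exp a * Real.exp (b - a) := by rw [← Real.exp_add]; ring_nf
  have h2 := Real.add_one_le_exp (b - a)
  have h3 := mul_le_mul_of_nonneg_left h2 (Real.exp_pos a).le
  have h4 := mul_nonneg (sub_nonneg.2 h) (Real.exp_pos b).le
  nlinarith

theorem abs_asianCallPayoff_sub_le {r S₀ σ K : ℝ} (hr : 0 < r) (hσ : 0 < σ) {b b' : ℝ → ℝ}
    (hb : Continuous b) (hb' : Continuous b') :
    |asianCallPayoff r K (assetPrice S₀ r σ b) - asianCallPayoff r K (assetPrice S₀ r σ b')| ≤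
      ∫ t in (0 : ℝ)..1, |S₀| * σ *
        (|b t - b' t| * (Real.exp (σ * b t) + Real.exp (σ * b' t))) := by
  have hi : ∀ {b : ℝ → ℝ}, Continuous b →
      IntervalIntegrable (assetPrice S₀ r σ b) volume 0 1 := by
    intro b hb
    refine Continuous.intervalIntegrable ?_ _ _
    unfold assetPrice
    fun_prop
  unfold asianCallPayoff
  rw [← mul_sub, abs_mul, Real.abs_exp]
  refine (mul_le_mul_of_nonneg_left (abs_max_sub_max_le_abs _ _ _) (Real.exp_pos _).le).trans ?_
  rw [sub_sub_sub_cancel_right, ← intervalIntegral.integral_sub (hi hb) (hi hb')]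
  refine (mul_le_mul_of_nonneg_left (intervalIntegral.abs_integral_le_integral_abs zero_le_one)
    (Real.exp_pos _).le).trans ?_
  rw [← intervalIntegral.integral_const_mul]
  refine intervalIntegral.integral_mono_on zero_le_one ?_ ?_ fun t ht => ?_
  · exact (((hi hb).sub (hi hb')).abs).const_mul _
  · exact Continuous.intervalIntegrable (by fun_prop) _ _
  -- Discounting absorbs the drift, because `r t ≤ r` on `[0,1]`.
  · have h1 : Real.exp (-r) * Real.exp ((r - σ ^ 2 / 2) * t) ≤ 1 := by
      rw [← Real.exp_add, Real.exp_le_one_iff]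
      nlinarith [ht.1, ht.2, sq_nonneg σ, mul_nonneg (sq_nonneg σ) ht.1]
    have h2 : assetPrice S₀ r σ b t - assetPrice S₀ r σ b' t =
        S₀ * Real.exp ((r - σ ^ 2 / 2) * t) * (Real.exp (σ * b t) - Real.exp (σ * b' t)) := by
      unfold assetPrice
      rw [Real.exp_add, Real.exp_add]
      ring
    have h3 := abs_exp_sub_exp_le (σ * b t) (σ * b' t)
    rw [← mul_sub, abs_mul, abs_of_pos hσ] at h3
    rw [h2, abs_mul, abs_mul, Real.abs_exp]
    calc _ = (Real.exp (-r) * Real.exp ((r - σ ^ 2 / 2) * t)) *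
          (|S₀| * |Real.exp (σ * b t) - Real.exp (σ * b' t)|) := by ring
      _ ≤ 1 * (|S₀| * (σ * |b t - b' t| * (Real.exp (σ * b t) + Real.exp (σ * b' t)))) := by
          gcongr
      _ = _ := by ring

end Deterministic

/-! ### Moment bounds and the mean truncation error -/

section Probability

open Filter Topology

variable {Ω : Type*} [MeasurableSpace Ω] {μ : Measure Ω} {X : ℕ → Ω → ℝ}

theorem sqrt_half_lt_one : √(1 / 2 : ℝ) < 1 := by
  rw [Real.sqrt_lt' one_pos]
  norm_num

/-- By independence the moment generating function is that of a centred Gaussian of variance `∑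
c_n²`, at most `1 + 1/2` and so at most 2 for every `N`. -/
theorem integrable_exp_lcTrunc (hX : ∀ j, HasLaw (X j) (gaussianReal 0 1) μ)
    (hind : iIndepFun X μ) (s : ℝ) (N : ℕ) {t : ℝ} (ht : t ∈ Icc (0 : ℝ) 1) :
    Integrable (fun ω => Real.exp (s * lcTrunc (fun j => X j ω) N t)) μ ∧
      ∫ ω, Real.exp (s * lcTrunc (fun j => X j ω) N t) ∂μ ≤ Real.exp (s ^ 2) := by
  have := hind.isProbabilityMeasure
  obtain ⟨k, c, hk, hc0, hc, h⟩ := exists_lcTrunc_eq t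
  have hY : iIndepFun (fun n ω => c n * X (k n) ω) μ :=
    (hind.precomp hk).comp (fun n x => c n * x) fun n => measurable_const_mul (c n)
  have hYm : ∀ n, AEMeasurable (fun ω => c n * X (k n) ω) μ := fun n =>
    (hX (k n)).aemeasurable.const_mul _
  have hmgf : mgf (fun ω => lcTrunc (fun j => X j ω) N t) μ s =
      Real.exp (s ^ 2 / 2 * ∑ n ∈ Finset.range (N + 1), c n ^ 2) := by
    have h1 : (fun ω => lcTrunc (fun j => X j ω) N t) =
        ∑ n ∈ Finset.range (N + 1), fun ω => c n * X (k n) ω := by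
      ext ω
      rw [h, Finset.sum_apply]
    rw [h1, hY.mgf_sum₀ hYm, Finset.mul_sum, Real.exp_sum]
    refine Finset.prod_congr rfl fun n _ => ?_
    rw [mgf_const_mul, mgf_gaussianReal (hX (k n)).map_eq]
    congr 1
    push_cast
    ring
  have hsum : ∑ n ∈ Finset.range (N + 1), c n ^ 2 ≤ 2 := by
    rw [Finset.sum_range_succ', hc0]
    have h1 : ∑ n ∈ Finset.range N, c (n + 1) ^ 2 ≤ ∑ n ∈ Finset.range N, (1 / 4) * (1 / 2 : ℝ) ^ n := by
      refine Finset.sum_le_sum fun n _ => ?_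
      rw [← sq_abs]
      refine (pow_le_pow_left₀ (abs_nonneg _) (hc n) 2).trans (le_of_eq ?_)
      rw [← pow_mul, mul_comm, pow_mul, Real.sq_sqrt (by norm_num)]
      ring
    have h2 : ∑ n ∈ Finset.range N, (1 / 2 : ℝ) ^ n ≤ 2 := sum_geometric_two_le N
    rw [← Finset.mul_sum] at h1
    nlinarith [ht.1, ht.2]
  -- A non-integrable exponential would have `mgf` zero by convention, so positivity gives
  -- integrability.
  refine ⟨mgf_pos_iff.1 (hmgf ▸ Real.exp_pos _), ?_⟩
  change mgf (fun ω => lcTrunc (fun j => X j ω) N t) μ s ≤ _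
  rw [hmgf]
  refine Real.exp_le_exp.2 ?_
  nlinarith [sq_nonneg s]

theorem exists_lintegral_abs_lcTrunc_sub_mul_exp_le
    (hX : ∀ j, HasLaw (X j) (gaussianReal 0 1) μ) (hind : iIndepFun X μ) (σ : ℝ) :
    ∃ C : ℝ, 0 ≤ C ∧ ∀ N M : ℕ, N ≤ M → ∀ t ∈ Icc (0 : ℝ) 1,
      ∫⁻ ω, ENNReal.ofReal (|lcTrunc (fun j => X j ω) M t - lcTrunc (fun j => X j ω) N t| *
        (Real.exp (σ * lcTrunc (fun j => X j ω) M t) +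
          Real.exp (σ * lcTrunc (fun j => X j ω) N t))) ∂μ ≤
        ENNReal.ofReal (C * √(1 / 2) ^ N) := by
  have hq := sqrt_half_lt_one
  have hq0 : (0 : ℝ) ≤ √(1 / 2) := Real.sqrt_nonneg _
  have hsq : Integrable (fun x : ℝ => x ^ 2) (gaussianReal 0 1) :=
    (memLp_id_gaussianReal 2).integrable_sq
  have hXi : ∀ j, Integrable (fun ω => X j ω ^ 2) μ := by
    intro j
    rw [← (hX j).map_eq] at hsq
    exact hsq.comp_aemeasurable (hX j).aemeasurable
  have hXe : ∀ j, ∫ ω, X j ω ^ 2 ∂μ = ∫ x, x ^ 2 ∂gaussianReal 0 1 := fun j =>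
    (hX j).integral_comp (f := fun x => x ^ 2) (by fun_prop)
  set A : ℝ := (∫ x, x ^ 2 ∂gaussianReal 0 1) + 2 * Real.exp ((2 * σ) ^ 2) with hA
  have hA0 : 0 ≤ A := add_nonneg (integral_nonneg fun x => sq_nonneg x) (by positivity)
  refine ⟨A * (1 - √(1 / 2))⁻¹, mul_nonneg hA0 (inv_nonneg.2 (by linarith)),
    fun N M hNM t ht => ?_⟩
  obtain ⟨k, c, -, -, hc, h⟩ := exists_lcTrunc_eq t
  obtain ⟨hiM, heM⟩ := integrable_exp_lcTrunc hX hind (2 * σ) M ht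
  obtain ⟨hiN, heN⟩ := integrable_exp_lcTrunc hX hind (2 * σ) N ht
  -- From `|x|(a + b) ≤ x² + a² + b²`: this separates the coefficient from the exponentials, which
  -- are not independent of it.
  set G : ℕ → Ω → ℝ := fun n ω => X (k n) ω ^ 2 +
    (Real.exp (2 * σ * lcTrunc (fun j => X j ω) M t) +
      Real.exp (2 * σ * lcTrunc (fun j => X j ω) N t)) with hG
  have hGi : ∀ n, Integrable (G n) μ := fun n => (hXi (k n)).add (hiM.add hiN)
  have hGe : ∀ n, ∫ ω, G n ω ∂μ ≤ A := by
    intro n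
    have h1 := integral_add (hXi (k n)) (hiM.add hiN)
    rw [integral_add' hiM hiN, hXe] at h1
    refine (le_of_eq h1).trans ?_
    linarith
  have hpt : ∀ ω, |lcTrunc (fun j => X j ω) M t - lcTrunc (fun j => X j ω) N t| *
      (Real.exp (σ * lcTrunc (fun j => X j ω) M t) +
        Real.exp (σ * lcTrunc (fun j => X j ω) N t)) ≤
      ∑ n ∈ Finset.Ico (N + 1) (M + 1), |c n| * G n ω := by
    intro ω
    have hd : lcTrunc (fun j => X j ω) M t - lcTrunc (fun j => X j ω) N t =
        ∑ n ∈ Finset.Ico (N + 1) (M + 1), c n * X (k n) ω := by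
      rw [h, h, Finset.sum_Ico_eq_sub _ (by omega)]
    have hsq : ∀ y, Real.exp (2 * σ * y) = Real.exp (σ * y) ^ 2 := by
      intro y
      rw [← Real.exp_nat_mul]
      congr 1
      push_cast
      ring
    rw [hd]
    refine (mul_le_mul_of_nonneg_right (Finset.abs_sum_le_sum_abs _ _) (by positivity)).trans ?_
    rw [Finset.sum_mul]
    refine Finset.sum_le_sum fun n _ => ?_
    rw [abs_mul, mul_assoc]
    refine mul_le_mul_of_nonneg_left ?_ (abs_nonneg _)
    simp only [hG, hsq]
    rw [← sq_abs (X (k n) ω)]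
    set a := Real.exp (σ * lcTrunc (fun j => X j ω) M t)
    set b := Real.exp (σ * lcTrunc (fun j => X j ω) N t)
    nlinarith [sq_nonneg (|X (k n) ω| - a), sq_nonneg (|X (k n) ω| - b), sq_nonneg a, sq_nonneg b]
  -- Geometric tail; two spare factors `√(1/2)` are discarded.
  have hsum : ∑ n ∈ Finset.Ico (N + 1) (M + 1), |c n| ≤ √(1 / 2) ^ N * (1 - √(1 / 2))⁻¹ := by
    rw [Finset.sum_Ico_eq_sum_range, ← tsum_geometric_of_lt_one hq0 hq]
    refine le_trans ?_ (mul_le_mul_of_nonneg_left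
      ((summable_geometric_of_lt_one hq0 hq).sum_le_tsum (Finset.range (M + 1 - (N + 1)))
        fun n _ => by positivity) (by positivity))
    rw [Finset.mul_sum]
    refine Finset.sum_le_sum fun n _ => ?_
    rw [show N + 1 + n = N + n + 1 by omega, ← pow_add]
    exact (hc _).trans (pow_le_pow_of_le_one hq0 hq.le (by omega))
  refine (lintegral_mono fun ω => ENNReal.ofReal_le_ofReal (hpt ω)).trans ?_
  rw [← ofReal_integral_eq_lintegral_ofReal
    (integrable_finsetSum _ fun n _ => (hGi n).const_mul _)
    (ae_of_all _ fun ω => Finset.sum_nonneg fun n _ => by positivity),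
    integral_finsetSum _ fun n _ => (hGi n).const_mul _]
  refine ENNReal.ofReal_le_ofReal ?_
  simp only [integral_const_mul]
  calc ∑ n ∈ Finset.Ico (N + 1) (M + 1), |c n| * ∫ ω, G n ω ∂μ
      ≤ ∑ n ∈ Finset.Ico (N + 1) (M + 1), |c n| * A :=
        Finset.sum_le_sum fun n _ => mul_le_mul_of_nonneg_left (hGe n) (abs_nonneg _)
    _ = (∑ n ∈ Finset.Ico (N + 1) (M + 1), |c n|) * A := (Finset.sum_mul _ _ _).symm
    _ ≤ √(1 / 2) ^ N * (1 - √(1 / 2))⁻¹ * A := mul_le_mul_of_nonneg_right hsum hA0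
    _ = _ := by ring

theorem measurable_lcTrunc_comp (hXm : ∀ j, Measurable (X j)) (N : ℕ) :
    Measurable fun p : Ω × ℝ => lcTrunc (fun j => X j p.1) N p.2 :=
  (measurable_lcTrunc N).comp
    ((measurable_pi_lambda _ fun j => (hXm j).comp measurable_fst).prodMk measurable_snd)

theorem measurable_asianCallPayoff_lcTrunc (hXm : ∀ j, Measurable (X j)) (S₀ r σ K : ℝ) (N : ℕ) :
    Measurable fun ω => asianCallPayoff r K (assetPrice S₀ r σ (lcTrunc (fun j => X j ω) N)) := by
  have h := measurable_lcTrunc_comp hXm N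
  have hS : Measurable fun p : Ω × ℝ =>
      assetPrice S₀ r σ (lcTrunc (fun j => X j p.1) N) p.2 := by
    unfold assetPrice
    fun_prop
  unfold asianCallPayoff
  simp only [intervalIntegral.integral_of_le (zero_le_one' ℝ)]
  have hI : Measurable fun ω =>
      ∫ t in Ioc (0 : ℝ) 1, assetPrice S₀ r σ (lcTrunc (fun j => X j ω) N) t :=
    hS.stronglyMeasurable.integral_prod_right'.measurable
  fun_prop

theorem exists_lintegral_abs_asianCallPayoff_sub_le (hXm : ∀ j, Measurable (X j))
    (hX : ∀ j, HasLaw (X j) (gaussianReal 0 1) μ) (hind : iIndepFun X μ)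
    {r σ : ℝ} (S₀ K : ℝ) (hr : 0 < r) (hσ : 0 < σ) :
    ∃ C : ℝ, 0 ≤ C ∧ ∀ N M : ℕ, N ≤ M →
      ∫⁻ ω, ENNReal.ofReal |asianCallPayoff r K (assetPrice S₀ r σ (lcTrunc (fun j => X j ω) M)) -
        asianCallPayoff r K (assetPrice S₀ r σ (lcTrunc (fun j => X j ω) N))| ∂μ ≤
      ENNReal.ofReal (C * √(1 / 2) ^ N) := by
  have := hind.isProbabilityMeasure
  obtain ⟨C, hC, hle⟩ := exists_lintegral_abs_lcTrunc_sub_mul_exp_le hX hind σ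
  refine ⟨|S₀| * σ * C, by positivity, fun N M hNM => ?_⟩
  have hM := measurable_lcTrunc_comp hXm M
  have hN := measurable_lcTrunc_comp hXm N
  set F : Ω → ℝ → ℝ := fun ω t =>
    |lcTrunc (fun j => X j ω) M t - lcTrunc (fun j => X j ω) N t| *
      (Real.exp (σ * lcTrunc (fun j => X j ω) M t) +
        Real.exp (σ * lcTrunc (fun j => X j ω) N t)) with hF
  have hF0 : ∀ ω t, 0 ≤ F ω t := fun ω t => by positivity
  have hFm : Measurable (Function.uncurry F) := by
    have := (hM.sub hN).norm
    simp only [Real.norm_eq_abs] at this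
    exact this.mul (((hM.const_mul σ).exp).add ((hN.const_mul σ).exp))
  have hpt : ∀ ω, ENNReal.ofReal
      |asianCallPayoff r K (assetPrice S₀ r σ (lcTrunc (fun j => X j ω) M)) -
        asianCallPayoff r K (assetPrice S₀ r σ (lcTrunc (fun j => X j ω) N))| ≤
      ENNReal.ofReal (|S₀| * σ) * ∫⁻ t in Ioc (0 : ℝ) 1, ENNReal.ofReal (F ω t) := by
    intro ω
    have c1 := continuous_lcTrunc (fun j => X j ω) M
    have c2 := continuous_lcTrunc (fun j => X j ω) N
    have hFc : Continuous (F ω) := by simp only [hF]; fun_prop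
    refine (ENNReal.ofReal_le_ofReal (abs_asianCallPayoff_sub_le hr hσ c1 c2)).trans (le_of_eq ?_)
    rw [intervalIntegral.integral_const_mul, ENNReal.ofReal_mul (by positivity),
      intervalIntegral.integral_of_le zero_le_one, ofReal_integral_eq_lintegral_ofReal
        ((hFc.intervalIntegrable 0 1).1) (ae_of_all _ (hF0 ω))]
  refine (lintegral_mono hpt).trans ?_
  rw [lintegral_const_mul' _ _ ENNReal.ofReal_ne_top, mul_assoc (|S₀| * σ),
    ENNReal.ofReal_mul (p := |S₀| * σ) (by positivity),
    lintegral_lintegral_swap (f := fun ω t => ENNReal.ofReal (F ω t)) hFm.ennreal_ofReal.aemeasurable]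
  refine mul_le_mul' le_rfl ?_
  calc ∫⁻ t in Ioc (0 : ℝ) 1, ∫⁻ ω, ENNReal.ofReal (F ω t) ∂μ
      ≤ ∫⁻ t in Ioc (0 : ℝ) 1, ENNReal.ofReal (C * √(1 / 2) ^ N) :=
        setLIntegral_mono measurable_const fun t ht => hle N M hNM t (Ioc_subset_Icc_self ht)
    _ = _ := by simp

/-- The series `∑ (j+1)^(-2) |X_j|^8` has finite expectation, hence is almost surely finite, and its
sum serves as `T`. Independence plays no role. -/
theorem ae_exists_pow_le (hX : ∀ j, HasLaw (X j) (gaussianReal 0 1) μ) :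
    ∀ᵐ ω ∂μ, ∃ T : ℝ, ∀ j, |X j ω| ^ 8 ≤ T * ((j : ℝ) + 1) ^ 2 := by
  set m := ∫⁻ x, ENNReal.ofReal (|x| ^ 8) ∂gaussianReal 0 1 with hm
  have hm_top : m ≠ ⊤ := by
    have h := (memLp_id_gaussianReal (μ := 0) (v := 1) 8).integrable_norm_pow (by norm_num)
    exact h.lintegral_lt_top.ne
  have hs : Summable fun j : ℕ => (((j : ℝ) + 1) ^ 2)⁻¹ := by
    have := (summable_nat_add_iff 1).2 (Real.summable_nat_pow_inv.2 one_lt_two)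
    simpa using this
  have hae : ∀ j : ℕ, AEMeasurable
      (fun ω => ENNReal.ofReal (((j : ℝ) + 1) ^ 2)⁻¹ * ENNReal.ofReal (|X j ω| ^ 8)) μ := fun j =>
    (((hX j).aemeasurable.norm.pow_const 8).ennreal_ofReal).const_mul _
  have hfin : ∫⁻ ω, ∑' j : ℕ, ENNReal.ofReal (((j : ℝ) + 1) ^ 2)⁻¹ *
      ENNReal.ofReal (|X j ω| ^ 8) ∂μ ≠ ⊤ := by
    rw [lintegral_tsum hae]
    have : ∀ j : ℕ, ∫⁻ ω, ENNReal.ofReal (((j : ℝ) + 1) ^ 2)⁻¹ *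
        ENNReal.ofReal (|X j ω| ^ 8) ∂μ = ENNReal.ofReal (((j : ℝ) + 1) ^ 2)⁻¹ * m := by
      intro j
      rw [lintegral_const_mul' _ _ ENNReal.ofReal_ne_top,
        (hX j).lintegral_comp (f := fun x => ENNReal.ofReal (|x| ^ 8)) (by fun_prop)]
    simp only [this]
    rw [ENNReal.tsum_mul_right]
    exact ENNReal.mul_ne_top hs.tsum_ofReal_ne_top hm_top
  filter_upwards [ae_lt_top' (AEMeasurable.tsum hae) hfin] with ω hω
  refine ⟨(∑' j : ℕ, ENNReal.ofReal (((j : ℝ) + 1) ^ 2)⁻¹ *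
      ENNReal.ofReal (|X j ω| ^ 8)).toReal, fun j => ?_⟩
  have h := ENNReal.toReal_mono hω.ne (ENNReal.le_tsum (f := fun j : ℕ =>
    ENNReal.ofReal (((j : ℝ) + 1) ^ 2)⁻¹ * ENNReal.ofReal (|X j ω| ^ 8)) j)
  rw [← ENNReal.ofReal_mul (by positivity), ENNReal.toReal_ofReal (by positivity)] at h
  rwa [inv_mul_le_iff₀ (by positivity), mul_comm] at h

/-- The truncation error in mean, for measurable coefficients. -/
theorem exists_integral_abs_sub_asianCallPayoff_le (hXm : ∀ j, Measurable (X j))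
    (hX : ∀ j, HasLaw (X j) (gaussianReal 0 1) μ) (hind : iIndepFun X μ)
    {r σ : ℝ} (S₀ K : ℝ) (hr : 0 < r) (hσ : 0 < σ) :
    ∃ C : ℝ, 0 < C ∧ ∀ N : ℕ,
      Integrable (fun ω => asianCallPayoff r K (assetPrice S₀ r σ (lcPath fun j => X j ω)) -
        asianCallPayoff r K (assetPrice S₀ r σ (lcTrunc (fun j => X j ω) N))) μ ∧
      ∫ ω, |asianCallPayoff r K (assetPrice S₀ r σ (lcPath fun j => X j ω)) -
        asianCallPayoff r K (assetPrice S₀ r σ (lcTrunc (fun j => X j ω) N))| ∂μ ≤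
      C * √(1 / 2) ^ N := by
  obtain ⟨C, hC, hle⟩ := exists_lintegral_abs_asianCallPayoff_sub_le hXm hX hind S₀ K hr hσ
  have hm := measurable_asianCallPayoff_lcTrunc hXm S₀ r σ K
  have hlim : ∀ᵐ ω ∂μ, Tendsto
      (fun N => asianCallPayoff r K (assetPrice S₀ r σ (lcTrunc (fun j => X j ω) N))) atTop
      (𝓝 (asianCallPayoff r K (assetPrice S₀ r σ (lcPath fun j => X j ω)))) := by
    filter_upwards [ae_exists_pow_le hX] with ω ⟨T, hT⟩
    exact tendsto_asianCallPayoff_lcTrunc hT S₀ r σ K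
  set Q : ℕ → Ω → ℝ := fun N ω =>
    asianCallPayoff r K (assetPrice S₀ r σ (lcTrunc (fun j => X j ω) N))
  set Q' : Ω → ℝ := fun ω => asianCallPayoff r K (assetPrice S₀ r σ (lcPath fun j => X j ω))
  refine ⟨C + 1, by positivity, fun N => ?_⟩
  have hQ' : AEMeasurable Q' μ := aemeasurable_of_tendsto_metrizable_ae' (fun N => (hm N).aemeasurable) hlim
  -- Fatou's lemma, applied to a bound uniform in `M ≥ N`.
  have hlint : ∫⁻ ω, ENNReal.ofReal |Q' ω - Q N ω| ∂μ ≤ ENNReal.ofReal (C * √(1 / 2) ^ N) := by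
    calc ∫⁻ ω, ENNReal.ofReal |Q' ω - Q N ω| ∂μ
        = ∫⁻ ω, liminf (fun M => ENNReal.ofReal |Q M ω - Q N ω|) atTop ∂μ := by
          refine lintegral_congr_ae (hlim.mono fun ω hω => ?_)
          exact (ENNReal.tendsto_ofReal ((hω.sub_const _).abs)).liminf_eq.symm
      _ ≤ liminf (fun M => ∫⁻ ω, ENNReal.ofReal |Q M ω - Q N ω| ∂μ) atTop :=
          lintegral_liminf_le fun M => ((hm M).sub (hm N)).norm.ennreal_ofReal
      _ ≤ ENNReal.ofReal (C * √(1 / 2) ^ N) :=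
          liminf_le_of_frequently_le'
            ((eventually_ge_atTop N).mono fun M hM => hle N M hM).frequently
  have hint : Integrable (fun ω => Q' ω - Q N ω) μ := by
    refine ⟨(hQ'.sub (hm N).aemeasurable).aestronglyMeasurable, ?_⟩
    rw [hasFiniteIntegral_iff_norm]
    exact hlint.trans_lt ENNReal.ofReal_lt_top
  refine ⟨hint, ?_⟩
  rw [integral_eq_lintegral_of_nonneg_ae (ae_of_all _ fun ω => abs_nonneg _)
    hint.abs.aestronglyMeasurable]
  refine (ENNReal.toReal_le_of_le_ofReal (by positivity) hlint).trans ?_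
  gcongr
  linarith

end Probability

/-! ### The two stated forms of the bound -/

theorem sqrt_half_pow_eq (N : ℕ) : √(1 / 2 : ℝ) ^ N = 1 / (2 : ℝ) ^ ((N : ℝ) / 2) := by
  rw [Real.sqrt_eq_rpow, ← Real.rpow_mul_natCast (by norm_num), one_div_mul_eq_div,
    Real.div_rpow zero_le_one zero_le_two, Real.one_rpow]


theorem mainTheorem3
    {Ω : Type*} [MeasurableSpace Ω] (μ : Measure Ω) [IsProbabilityMeasure μ]
    -- independent standard normal coefficients
    (X : ℕ → Ω → ℝ) (hX : ∀ j, HasLaw (X j) (gaussianReal 0 1) μ) (hind : iIndepFun X μ)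
    -- almost surely, the path of `B` on `[0,1]` is the Lévy–Ciesielski series
    (B : ℝ → Ω → ℝ)
    (hB : ∀ᵐ ω ∂μ, ∀ t ∈ Icc (0 : ℝ) 1, B t ω = lcPath (fun j => X j ω) t)
    (S₀ r σ K : ℝ) (hr : 0 < r) (hσ : 0 < σ)
    (P : Ω → ℝ)
    (hP : ∀ ω, P ω = asianCallPayoff r K (assetPrice S₀ r σ (fun t => B t ω)))
    (PN : ℕ → Ω → ℝ)
    (hPN : ∀ N ω, PN N ω =
      asianCallPayoff r K (assetPrice S₀ r σ (lcTrunc (fun j => X j ω) N))) :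
    -- the objects are well defined: almost surely the series converges and `B` is continuous
    (∀ᵐ ω ∂μ, (∀ t ∈ Icc (0 : ℝ) 1, Summable fun n : ℕ => lcLevel (fun j => X j ω) (n + 1) t) ∧
      ContinuousOn (fun t => B t ω) (Icc 0 1)) ∧
    (∀ N : ℕ, 1 ≤ N → Integrable (fun ω => P ω - PN N ω) μ) ∧
    -- the two forms of the error bound, with `d = 2 ^ N`
    (∃ C : ℝ, 0 < C ∧ ∀ N : ℕ, 1 ≤ N →
      ∫ ω, |P ω - PN N ω| ∂μ ≤ C * (Real.sqrt N / (2 : ℝ) ^ ((N : ℝ) / 2))) ∧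
    (∃ C : ℝ, 0 < C ∧ ∀ N : ℕ, 1 ≤ N → ∀ d : ℝ, d = 2 ^ N →
      ∫ ω, |P ω - PN N ω| ∂μ ≤ C * Real.sqrt (Real.log d / d)) := by
  -- `HasLaw` gives only a.e. measurability, while Tonelli is applied to jointly measurable paths; a
  -- measurable version changes no integral.
  obtain ⟨Y, hYm, hXY⟩ : ∃ Y : ℕ → Ω → ℝ, (∀ j, Measurable (Y j)) ∧ ∀ j, X j =ᵐ[μ] Y j :=
    ⟨fun j => (hX j).aemeasurable.mk, fun j => (hX j).aemeasurable.measurable_mk,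
      fun j => (hX j).aemeasurable.ae_eq_mk⟩
  have hXYω : ∀ᵐ ω ∂μ, (fun j => X j ω) = fun j => Y j ω :=
    (ae_all_iff.2 hXY).mono fun ω hω => funext hω
  obtain ⟨C, hC, hmain⟩ := exists_integral_abs_sub_asianCallPayoff_le hYm
    (fun j => (hX j).congr (hXY j).symm) (hind.congr hXY) S₀ K hr hσ
  have heq : ∀ N, (fun ω => P ω - PN N ω) =ᵐ[μ] fun ω =>
      asianCallPayoff r K (assetPrice S₀ r σ (lcPath fun j => Y j ω)) -
        asianCallPayoff r K (assetPrice S₀ r σ (lcTrunc (fun j => Y j ω) N)) := by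
    intro N
    filter_upwards [hB, hXYω] with ω hω hxy
    rw [hP, hPN, ← hxy, asianCallPayoff_congr hω]
  have hbound : ∀ N, ∫ ω, |P ω - PN N ω| ∂μ ≤ C * √(1 / 2) ^ N := by
    intro N
    rw [integral_congr_ae ((heq N).mono fun ω hω => congrArg abs hω)]
    exact (hmain N).2
  refine ⟨?_, fun N _ => (hmain N).1.congr (heq N).symm, ⟨C, hC, fun N hN => ?_⟩,
    ⟨C / √(Real.log 2), div_pos hC (Real.sqrt_pos.2 (Real.log_pos one_lt_two)),
      fun N hN d hd => ?_⟩⟩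
  · filter_upwards [hB, ae_exists_pow_le hX] with ω hω ⟨T, hT⟩
    refine ⟨fun t _ => ?_, (continuous_lcPath hT).continuousOn.congr hω⟩
    obtain ⟨u, hu, hle⟩ := exists_summable_bound_lcLevel hT
    exact Summable.of_norm_bounded hu fun n => hle n t
  · refine (hbound N).trans (mul_le_mul_of_nonneg_left ?_ hC.le)
    rw [sqrt_half_pow_eq]
    gcongr
    exact Real.one_le_sqrt.2 (by exact_mod_cast hN)
  · refine (hbound N).trans ?_
    have h2 : 0 < √(Real.log 2) := Real.sqrt_pos.2 (Real.log_pos one_lt_two)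
    -- This identity dictates the constant `C / √(log 2)`; the remaining `√N ≥ 1` is slack.
    have hd2 : √(Real.log d / d) = √N * √(Real.log 2) * √(1 / 2) ^ N := by
      rw [hd, Real.log_pow, Real.sqrt_div' _ (by positivity), Real.sqrt_mul (by positivity),
        Real.sqrt_div zero_le_one, Real.sqrt_one, div_pow, one_pow, mul_one_div]
      congr 1
      rw [Real.sqrt_eq_iff_mul_self_eq (by positivity) (by positivity), ← mul_pow,
        Real.mul_self_sqrt zero_le_two]
    have hN1 : 1 ≤ √(N : ℝ) := Real.one_le_sqrt.2 (by exact_mod_cast hN)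
    rw [hd2]
    calc C * √(1 / 2) ^ N ≤ √N * (C * √(1 / 2) ^ N) :=
          le_mul_of_one_le_left (by positivity) hN1
      _ = C / √(Real.log 2) * (√N * √(Real.log 2) * √(1 / 2) ^ N) := by
          field_simp
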